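/- Let $G$ be a connected regular finite simple graph of order $n \ge 2$, and let $\lambda$ be an eigenvalue of its Laplacian matrix $L(G) = D(G) - A(G)$, where $D(G)$ is the diagonal matrix of vertex degrees and $A(G)$ is the adjacency matrix, with multiplicity $m_G(\lambda)$. Let $\gamma(G)$ be the domination number of $G$, that is, the minimum size of a set $S$ of vertices such that every vertex not in $S$ is adjacent to some vertex in $S$. Then $$\gamma(G) \le n - m_G(\lambda).$$ -/

import Mathlib

namespace SimpleGraph

/-- A set `S` of vertices is dominating if every vertex outside `S` is adjacent to some vertex
of `S`. -/
def IsDominatingSet {V : Type*} (G : SimpleGraph V) (S : Finset V) : Prop :=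
  ∀ v : V, v ∉ S → ∃ w ∈ S, G.Adj v w

/-- The domination number of a finite graph: the minimum size of a dominating set. -/
noncomputable def dominationNumber {V : Type*} [Fintype V] (G : SimpleGraph V) : ℕ :=
  sInf {k : ℕ | ∃ S : Finset V, G.IsDominatingSet S ∧ S.card = k}

/-- The minimum defining the domination number is attained. -/
theorem dominationNumber_isLeast {V : Type*} [Fintype V] (G : SimpleGraph V) :
    IsLeast {k : ℕ | ∃ S : Finset V, G.IsDominatingSet S ∧ S.card = k} G.dominationNumber :=
  ⟨Nat.sInf_mem ⟨_, Finset.univ, fun v hv => absurd (Finset.mem_univ v) hv, rfl⟩,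
    fun _ hk => Nat.sInf_le hk⟩

/-- `μ` is a Laplacian eigenvalue of `G`: an eigenvalue of the matrix `L(G) = D(G) - A(G)`. -/
def IsLaplacianEigenvalue {V : Type*} [Fintype V] [DecidableEq V] (G : SimpleGraph V)
    [DecidableRel G.Adj] (μ : ℝ) : Prop :=
  Module.End.HasEigenvalue (Matrix.toLin' (G.lapMatrix ℝ)) μ

/-- The multiplicity of `μ` as a Laplacian eigenvalue of `G`: the dimension of its eigenspace
(the matrix `L(G)` is real symmetric, so this is also the algebraic multiplicity). -/
noncomputable def laplacianMultiplicity {V : Type*} [Fintype V] [DecidableEq V]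
    (G : SimpleGraph V) [DecidableRel G.Adj] (μ : ℝ) : ℕ :=
  Module.finrank ℝ (Module.End.eigenspace (Matrix.toLin' (G.lapMatrix ℝ)) μ)

end SimpleGraph

/-! Pick `m` coordinates `X` on which `μ`-eigenvectors are arbitrary. If `v ∈ X` had no neighbour
outside `X`, row `v` of `L - μI` would be supported in `X`. An eigenvector equal to that row on `X`
forces its sum of squares to be 0, yet the entry at any neighbour of `v` is -1. So `Xᶜ` dominates.
-/

/-- A finite-dimensional space of functions has a set of coordinates, as many as its dimension,
on which its elements take arbitrary values. -/
theorem Submodule.exists_finset_card_eq_finrank_forall_exists_eqOn {ι K : Type*} [Fintype ι]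
    [Field K] (E : Submodule K (ι → K)) :
    ∃ X : Finset ι, X.card = Module.finrank K E ∧
      ∀ g : ι → K, ∃ x ∈ E, ∀ i ∈ X, x i = g i := by
  classical
  let f : ι → Module.Dual K E := fun i => (LinearMap.proj i).comp E.subtype
  -- `b` indexes a basis of the span of the coordinate functionals on `E`.
  obtain ⟨b, -, -, hspan, hli⟩ :=
    exists_linearIndepOn_extension (K := K) (v := f) (s := ∅) (t := Set.univ)
      (linearIndepOn_empty K f) (Set.empty_subset _)
  let P : E →ₗ[K] (b → K) := LinearMap.pi fun i => f i
  have hinj : Function.Injective P := by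
    rw [injective_iff_map_eq_zero]
    intro x hx
    have hle : Submodule.span K (f '' b) ≤ LinearMap.ker (Module.Dual.eval K E x) := by
      rw [Submodule.span_le]
      rintro _ ⟨i, hi, rfl⟩
      exact congrFun hx ⟨i, hi⟩
    ext i
    exact hle (hspan ⟨i, Set.mem_univ i, rfl⟩)
  have hcard : Fintype.card b = Module.finrank K E := by
    apply le_antisymm
    · simpa [Subspace.dual_finrank_eq] using
        LinearIndependent.fintype_card_le_finrank (R := K) hli
    · simpa using LinearMap.finrank_le_finrank_of_injective hinj
  have hsurj : Function.Surjective P :=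
    (LinearMap.injective_iff_surjective_of_finrank_eq_finrank (by simp [hcard])).1 hinj
  refine ⟨b.toFinset, by rw [Set.toFinset_card, hcard], fun g => ?_⟩
  obtain ⟨x, hx⟩ := hsurj fun i => g i
  exact ⟨x, x.2, fun i hi => congrFun hx ⟨i, Set.mem_toFinset.1 hi⟩⟩

namespace SimpleGraph

/-- In a graph without isolated vertices, the complement of a set of coordinates on which the
eigenvectors of the Laplacian take arbitrary values is dominating. -/
theorem isDominatingSet_compl_of_forall_exists_eqOn {V : Type*} [Fintype V] [DecidableEq V]
    (G : SimpleGraph V) [DecidableRel G.Adj] (hG : ∀ v, ∃ w, G.Adj v w) (μ : ℝ) (X : Finset V)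
    (hX : ∀ g : V → ℝ, ∃ x ∈ Module.End.eigenspace (Matrix.toLin' (G.lapMatrix ℝ)) μ,
      ∀ v ∈ X, x v = g v) :
    G.IsDominatingSet Xᶜ := by
  intro v hv
  by_contra! hnot
  let M : Matrix V V ℝ := G.lapMatrix ℝ - Matrix.scalar V μ
  have hM : ∀ w, w ≠ v → M v w = if G.Adj v w then -1 else 0 := by
    intro w hw
    simp only [M, lapMatrix, degMatrix, Matrix.sub_apply, Matrix.scalar_apply,
      Matrix.diagonal_apply_ne _ hw.symm, adjMatrix_apply]
    split_ifs <;> simp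
  -- The prescribed values are row `v` itself, so the row equation becomes a sum of squares.
  obtain ⟨x, hxE, hx⟩ := hX (M v)
  have hrow : ∑ w, M v w * x w = 0 := by
    have h := congrFun (Module.End.mem_eigenspace_iff.1 hxE) v
    rw [Matrix.toLin'_apply] at h
    have h' : (M.mulVec x) v = 0 := by
      simp [M, Matrix.sub_mulVec, h]
    exact h'
  have hsq : ∀ w, M v w * x w = M v w ^ 2 := by
    intro w
    by_cases hw : w ∈ X
    · rw [hx w hw, sq]
    · have hwv : w ≠ v := by
        rintro rfl
        exact hv (Finset.mem_compl.2 hw)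
      simp [hM w hwv, hnot w (Finset.mem_compl.2 hw)]
  simp only [hsq] at hrow
  obtain ⟨w, hw⟩ := hG v
  have h0 := (Finset.sum_eq_zero_iff_of_nonneg fun w _ => sq_nonneg (M v w)).1 hrow w
    (Finset.mem_univ w)
  simp [hM w hw.ne', hw] at h0

end SimpleGraph

theorem mainTheorem6 {V : Type*} [Fintype V] [DecidableEq V] (G : SimpleGraph V)
    [DecidableRel G.Adj] (n k : ℕ) (hn : Fintype.card V = n) (hn2 : 2 ≤ n)
    (hconn : G.Connected) (hreg : G.IsRegularOfDegree k)
    (μ : ℝ) (hμ : G.IsLaplacianEigenvalue μ) :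
    (G.dominationNumber : ℤ) ≤ (n : ℤ) - (G.laplacianMultiplicity μ : ℤ) := by
  have : Nontrivial V := Fintype.one_lt_card_iff_nontrivial.1 (by omega)
  obtain ⟨X, hcard, hX⟩ := Submodule.exists_finset_card_eq_finrank_forall_exists_eqOn
    (Module.End.eigenspace (Matrix.toLin' (G.lapMatrix ℝ)) μ)
  have hdom := G.isDominatingSet_compl_of_forall_exists_eqOn
    (fun v => hconn.preconnected.exists_adj_of_nontrivial v) μ X hX
  have hle : G.dominationNumber ≤ Xᶜ.card := G.dominationNumber_isLeast.2 ⟨_, hdom, rfl⟩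
  have hsum := X.card_add_card_compl
  have hmul : G.laplacianMultiplicity μ = X.card := hcard.symm
  omega
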